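/- Consider deterministic learners given by a Turing machine with a base tape (Tape 0) and one additional stack, over finite state sets and alphabets. Tape 0 is one-sided infinite and has an unmodifiable marker at its left end. The learner works in cycles. At the beginning of a cycle the machine is in its start state, with the head at the left end of Tape 0, and Tape 0 contains the convolution of the current datum $x\in\{0,1\}^*$ and the old memory. The machine runs until it halts, in each step reading and writing the scanned cell of Tape 0, moving the head by at most one cell, and pushing or popping at most one stack symbol. When it halts, the word on Tape 0 before the first blank must be the convolution of the new hypothesis and the new memory. The stack content is carried over unchanged to the next cycle; at the very beginning the stack is empty and the memory is a fixed word. In the cycle with the $(i+1)$-st datum $x_i$ let $$n_i=\lfloor\log_2(i+1)\rfloor+\max_{j\le i}|x_j| .$$ Assume that there is a constant $c$ such that, on every sequence $x_0,x_1,\dots$ in $\{0,1\}^*$ and for every $i$, the cycle with datum $x_i$ halts with such an output after at most $c\,(n_i+1)$ steps, and the new memory and the hypothesis both have length at most $n_i+c$. A text for a language $L\subseteq\{0,1\}^*$ is a sequence $x_0,x_1,\dots$ with $\{x_i : i\ge 0\}=L$. Let a hypothesis space be given, that is, a map $d\mapsto H_d\subseteq\{0,1\}^*$ on the words $d$ over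 the hypothesis alphabet. The learner learns $L$ if, on every text for $L$, its hypotheses are from some cycle on equal to one fixed $d$ with $H_d=L$; it learns a class if it learns every language in the class. Theorem. No such learner, with any hypothesis space, learns the class of all $L_e=\{0,1\}^*\setminus\{e\}$, $e\in\{0,1\}^*$. -/

import Mathlib

/-- The convolution of two words: symbols at the same position are paired, and the shorter word is
padded (by `none`) up to the length of the longer one. -/
def wordConv {α β : Type} (x : List α) (y : List β) : List (Option α × Option β) :=
  (List.range (max x.length y.length)).map fun i => (x[i]?, y[i]?)

/-- The symbols in the cells of Tape 0 to the right of the left-end marker: the default (empty)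
symbol, the symbols of convolutions of a datum (a binary word) with the old memory, the symbols of
convolutions of a hypothesis with the new memory, and auxiliary work symbols. -/
inductive BaseSym (Mem Hyp Work : Type) : Type
  | blank : BaseSym Mem Hyp Work
  | datum : Option Bool × Option Mem → BaseSym Mem Hyp Work
  | result : Option Hyp × Option Mem → BaseSym Mem Hyp Work
  | work : Work → BaseSym Mem Hyp Work

/-- Head movements on Tape 0. -/
inductive Move : Type
  | left : Move
  | stay : Move
  | right : Move

/-- The actions on the stack in one step. -/
inductive StackOp (Stk : Type) : Type
  | keep : StackOp Stk
  | pop : StackOp Stk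
  | push : Stk → StackOp Stk

/-- A (deterministic) Turing machine learner for languages over `{0,1}` with a base tape (Tape 0)
and one additional stack. All state sets and alphabets are finite. `next` is the transition
function: from the state, the scanned symbol of Tape 0 (`none` is the left-end marker) and the top
symbol of the stack (`none` if the stack is empty) it gives the new state, the symbol written on
Tape 0, the head movement and the stack action; the machine halts where `next` is `none`. -/
structure StackLearner where
  State : Type
  Mem : Type
  Hyp : Type
  Work : Type
  Stk : Type
  finite_state : Finite State
  finite_mem : Finite Mem
  finite_hyp : Finite Hyp
  finite_work : Finite Work
  finite_stk : Finite Stk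
  start : State
  initMem : List Mem
  next : State → Option (BaseSym Mem Hyp Work) → Option Stk →
    Option (State × BaseSym Mem Hyp Work × Move × StackOp Stk)

namespace StackLearner

/-- The alphabet of Tape 0. -/
abbrev Sym (M : StackLearner) : Type := BaseSym M.Mem M.Hyp M.Work

/-- A configuration inside a cycle. Tape 0 is one-sided infinite; cell number `0` carries the
left-end marker, and `tape k` is the content of cell number `k + 1`. The head of the list `stack`
is the top of the stack. -/
structure Cfg (M : StackLearner) : Type where
  state : M.State
  head : ℕ
  tape : ℕ → M.Sym
  stack : List M.Stk

/-- The scanned symbol of Tape 0; `none` is the left-end marker. -/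
def read (M : StackLearner) (head : ℕ) (tape : ℕ → M.Sym) : Option M.Sym :=
  match head with
  | 0 => none
  | k + 1 => some (tape k)

/-- Writing on Tape 0; the left-end marker cannot be modified. -/
def write (M : StackLearner) (head : ℕ) (tape : ℕ → M.Sym) (a : M.Sym) : ℕ → M.Sym :=
  match head with
  | 0 => tape
  | k + 1 => Function.update tape k a

/-- Moving the head; it cannot move left of the left-end marker. -/
def moveHead (d : Move) (head : ℕ) : ℕ :=
  match d with
  | .left => head - 1
  | .stay => head
  | .right => head + 1

/-- Performing an action on the stack. -/
def applyOp {Stk : Type} (o : StackOp Stk) (s : List Stk) : List Stk :=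
  match o with
  | .keep => s
  | .pop => s.tail
  | .push a => a :: s

/-- One step of the computation; `none` if the machine has halted. -/
def step (M : StackLearner) (C : M.Cfg) : Option M.Cfg :=
  (M.next C.state (M.read C.head C.tape) C.stack.head?).map fun r =>
    { state := r.1
      head := moveHead r.2.2.1 C.head
      tape := M.write C.head C.tape r.2.1
      stack := applyOp r.2.2.2 C.stack }

/-- The configuration after `t` steps, or the halting one if the machine halts earlier. -/
def runFor (M : StackLearner) (t : ℕ) (C : M.Cfg) : M.Cfg :=
  (fun D => (M.step D).getD D)^[t] C

/-- The configuration at the beginning of a cycle: Tape 0 holds the convolution of the datum `x`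
and the memory `mem`, and its head is at the left-end marker. -/
def initCfg (M : StackLearner) (mem : List M.Mem) (stk : List M.Stk) (x : List Bool) : M.Cfg where
  state := M.start
  head := 0
  tape := fun k => (((wordConv x mem).map BaseSym.datum)[k]?).getD BaseSym.blank
  stack := stk

/-- The word on Tape 0 between the left-end marker and the first blank is the convolution of the
hypothesis `hyp` and the memory `mem`. -/
def Outputs (M : StackLearner) (tape : ℕ → M.Sym) (hyp : List M.Hyp) (mem : List M.Mem) : Prop :=
  (∀ k, ∀ p ∈ (wordConv hyp mem)[k]?, tape k = BaseSym.result p) ∧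
    tape (wordConv hyp mem).length = BaseSym.blank

/-- One cycle of the learner: with memory `mem` and stack content `stk` it reads the datum `x`,
halts within `t` steps, and ends with memory `mem'`, stack content `stk'` and hypothesis `hyp`. -/
def Cycle (M : StackLearner) (t : ℕ) (mem : List M.Mem) (stk : List M.Stk) (x : List Bool)
    (mem' : List M.Mem) (stk' : List M.Stk) (hyp : List M.Hyp) : Prop :=
  M.step (M.runFor t (M.initCfg mem stk x)) = none ∧
    M.Outputs (M.runFor t (M.initCfg mem stk x)).tape hyp mem' ∧
    (M.runFor t (M.initCfg mem stk x)).stack = stk'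

/-- What a learner produces on an infinite sequence of data: its memory and its stack content
before cycle `i`, and its hypothesis at the end of cycle `i`. -/
structure Trace (M : StackLearner) : Type where
  mem : ℕ → List M.Mem
  stk : ℕ → List M.Stk
  hyp : ℕ → List M.Hyp

/-- `τ` is what `M` produces on the data `T 0, T 1, …`, where cycle `i` takes at most `t i` steps.
Memory and stack persist from cycle to cycle; the stack is empty at the very beginning. -/
def IsTrace (M : StackLearner) (T : ℕ → List Bool) (t : ℕ → ℕ) (τ : M.Trace) : Prop :=
  τ.mem 0 = M.initMem ∧ τ.stk 0 = [] ∧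
    ∀ i, M.Cycle (t i) (τ.mem i) (τ.stk i) (T i) (τ.mem (i + 1)) (τ.stk (i + 1)) (τ.hyp i)

/-- The parameter `n` in cycle `i` (starting from `0`): the (rounded down) binary logarithm of the
number of data seen so far, counted with repetitions, plus the length of the longest datum seen so
far; the current datum is included. -/
def sizeParam (T : ℕ → List Bool) (i : ℕ) : ℕ :=
  Nat.log 2 (i + 1) + (Finset.range (i + 1)).sup fun j => (T j).length

/-- The resource bounds: on every sequence of data, every cycle halts with a legal output after a
number of steps that is linear in the current `n`, and the memory and the hypothesis left on
Tape 0 are no longer than `n`, up to an additive constant. -/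
def LinearTime (M : StackLearner) : Prop :=
  ∃ c : ℕ, ∀ T : ℕ → List Bool, ∃ τ : M.Trace,
    M.IsTrace T (fun i => c * (sizeParam T i + 1)) τ ∧
      ∀ i, (τ.mem (i + 1)).length ≤ sizeParam T i + c ∧ (τ.hyp i).length ≤ sizeParam T i + c

/-- `M` learns the language `L` in the hypothesis space `H`: on every text for `L` its hypotheses
converge to one index of `L`. -/
def Learns (M : StackLearner) (H : List M.Hyp → Set (List Bool)) (L : Set (List Bool)) : Prop :=
  ∀ T : ℕ → List Bool, Set.range T = L →
    ∃ (t : ℕ → ℕ) (τ : M.Trace), M.IsTrace T t τ ∧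
      ∃ (k : ℕ) (d : List M.Hyp), H d = L ∧ ∀ i, k ≤ i → τ.hyp i = d

/-- `M` learns a class of languages if it learns each language in it. -/
def LearnsClass (M : StackLearner) (H : List M.Hyp → Set (List Bool))
    (𝓛 : Set (Set (List Bool))) : Prop :=
  ∀ L ∈ 𝓛, M.Learns H L

end StackLearner

/-! Choosing one word from each of `2 ^ b` pairs gives `2 ^ 2 ^ b` possible pasts. If `g` occurs in
one past only and `g'` in another only, a common continuation by all words except `g` and `g'`
yields texts for two different languages of the class, so the learner must not behave alike on both
(`LinearTimeWith.no_collision`). The memory has only `O(b)` symbols, so the difference must sit on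
the stack. One cycle reaches only `O(n)` symbols deep; what lies below is useless unless the stack
comes down. The proof builds a continuation on which it never does.

Fresh information keeps the stack up (`LinearTimeWith.exists_protecting`). Suppose that after every
choice of words of length `i + 1` the stack could be brought down near a prescribed level by data of
bounded size without words of that length. At that moment only the memory, the level and the few
symbols above it would depend on the choice, and pigeonhole would give a collision. So some choice
protects its level. Under this protection one presents the shorter words still due and a choice of
words of length `i + 2` that takes over the protection (`Guarded.exists_succ`). The limit is an
enumeration of all words except `g` and `g'` (`Guarded.exists_seq`).

To start, the data are cut where the stack is lowest (`LinearTimeWith.exists_guarded`): from there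
on, the memory and the top `O(n)` symbols decide everything. A second pigeonhole finds two pasts
agreeing in these. -/

/-! ### Determinism of cycles -/

theorem wordConv_getElem? {α β : Type} (x : List α) (y : List β) (k : ℕ) :
    (wordConv x y)[k]? =
      if k < (wordConv x y).length then some (x[k]?, y[k]?) else none := by
  by_cases hk : k < max x.length y.length
  · simp [wordConv, hk]
  · simp [wordConv, hk]

theorem length_wordConv {α β : Type} (x : List α) (y : List β) :
    (wordConv x y).length = max x.length y.length := by
  simp [wordConv]

namespace StackLearner

variable {M : StackLearner}

/-- The blank that ends the shorter word would lie inside the longer one, where only `result`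
symbols stand. -/
theorem Outputs.length_le {tape : ℕ → M.Sym} {h h' : List M.Hyp} {m m' : List M.Mem}
    (H : M.Outputs tape h m) (H' : M.Outputs tape h' m') :
    (wordConv h' m').length ≤ (wordConv h m).length := by
  by_contra! hlt
  have h1 := H.2
  have h2 := H'.1 (wordConv h m).length (h'[(wordConv h m).length]?, m'[(wordConv h m).length]?)
    (by rw [wordConv_getElem?, if_pos hlt]; rfl)
  rw [h1] at h2
  cases h2

theorem Outputs.unique {tape : ℕ → M.Sym} {h h' : List M.Hyp} {m m' : List M.Mem}
    (H : M.Outputs tape h m) (H' : M.Outputs tape h' m') : h = h' ∧ m = m' := by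
  have hl : (wordConv h m).length = (wordConv h' m').length :=
    le_antisymm (H'.length_le H) (H.length_le H')
  have key : ∀ k : ℕ, h[k]? = h'[k]? ∧ m[k]? = m'[k]? := by
    intro k
    by_cases hk : k < (wordConv h m).length
    · have h1 := H.1 k (h[k]?, m[k]?) (by rw [wordConv_getElem?, if_pos hk]; rfl)
      have h2 := H'.1 k (h'[k]?, m'[k]?) (by rw [wordConv_getElem?, if_pos (hl ▸ hk)]; rfl)
      rw [h1] at h2
      injection h2 with h3
      simpa using h3
    · have hk' := hl ▸ hk
      rw [length_wordConv] at hk hk'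
      rw [List.getElem?_eq_none, List.getElem?_eq_none, List.getElem?_eq_none,
        List.getElem?_eq_none]
      · exact ⟨rfl, rfl⟩
      all_goals omega
  exact ⟨List.ext_getElem? fun k => (key k).1, List.ext_getElem? fun k => (key k).2⟩

theorem runFor_succ (t : ℕ) (C : M.Cfg) :
    M.runFor (t + 1) C = (M.step (M.runFor t C)).getD (M.runFor t C) := by
  simp only [runFor, Function.iterate_succ_apply']

theorem runFor_add_of_halted {t : ℕ} {C : M.Cfg} (h : M.step (M.runFor t C) = none) (s : ℕ) :
    M.runFor (t + s) C = M.runFor t C := by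
  induction s with
  | zero => rfl
  | succ s ih => rw [← add_assoc, runFor_succ, ih, h]; rfl

theorem Cycle.mono {t t' : ℕ} (htt : t ≤ t') {m m' : List M.Mem} {s s' : List M.Stk}
    {x : List Bool} {h : List M.Hyp} (H : M.Cycle t m s x m' s' h) :
    M.Cycle t' m s x m' s' h := by
  obtain ⟨d, rfl⟩ := Nat.exists_eq_add_of_le htt
  unfold Cycle
  rw [runFor_add_of_halted H.1]
  exact H

/-- Needed because the time bound and learnability each supply a trace of their own. -/
theorem Cycle.unique {t t' : ℕ} {m m₁ m₂ : List M.Mem} {s s₁ s₂ : List M.Stk}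
    {x : List Bool} {h₁ h₂ : List M.Hyp} (H₁ : M.Cycle t m s x m₁ s₁ h₁)
    (H₂ : M.Cycle t' m s x m₂ s₂ h₂) : m₁ = m₂ ∧ s₁ = s₂ ∧ h₁ = h₂ := by
  replace H₁ := H₁.mono (le_max_left t t')
  replace H₂ := H₂.mono (le_max_right t t')
  obtain ⟨e1, e2⟩ := H₁.2.1.unique H₂.2.1
  exact ⟨e2, H₁.2.2.symm.trans H₂.2.2, e1⟩

/-! ### The part of the stack out of reach of a cycle -/

/-- The configuration with further symbols `v` at the bottom of the stack. -/
def Cfg.under (C : M.Cfg) (v : List M.Stk) : M.Cfg :=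
  { C with stack := C.stack ++ v }

/-- A step looks at the top symbol only and removes at most that one. -/
theorem step_under {C : M.Cfg} (hC : C.stack ≠ []) (v : List M.Stk) :
    M.step (C.under v) = (M.step C).map fun D => D.under v := by
  obtain ⟨q, hd, tp, stk⟩ := C
  cases stk with
  | nil => exact absurd rfl hC
  | cons a l =>
    simp only [step, Cfg.under, List.cons_append, List.head?_cons, Option.map_map]
    congr 1
    funext ⟨q', a', d, o⟩
    cases o <;> rfl

theorem length_le_of_step {C D : M.Cfg} (h : M.step C = some D) :
    C.stack.length ≤ D.stack.length + 1 ∧ D.stack.length ≤ C.stack.length + 1 := by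
  simp only [step, Option.map_eq_some_iff] at h
  obtain ⟨⟨q', a', d, o⟩, -, rfl⟩ := h
  cases o <;> simp [applyOp] <;> omega

theorem length_runFor (t : ℕ) (C : M.Cfg) :
    C.stack.length ≤ (M.runFor t C).stack.length + t ∧
      (M.runFor t C).stack.length ≤ C.stack.length + t := by
  induction t with
  | zero => simp [runFor]
  | succ t ih =>
    rw [runFor_succ]
    cases h : M.step (M.runFor t C) with
    | none => simp only [Option.getD_none]; omega
    | some D =>
      have := length_le_of_step h
      simp only [Option.getD_some]
      omega

theorem runFor_under {t : ℕ} {C : M.Cfg} (ht : t ≤ C.stack.length) (v : List M.Stk) :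
    M.runFor t (C.under v) = (M.runFor t C).under v := by
  induction t with
  | zero => rfl
  | succ t ih =>
    have hne : (M.runFor t C).stack ≠ [] := by
      have := (length_runFor t C).1
      intro h
      rw [h] at this
      simp at this
      omega
    rw [runFor_succ, runFor_succ, ih (by omega), step_under hne]
    cases M.step (M.runFor t C) <;> rfl

/-- A cycle with fewer steps than there are symbols in the upper part `u` of the stack does not
depend on the part below. -/
theorem cycle_append {t : ℕ} {m m' : List M.Mem} {u v s : List M.Stk} {x : List Bool}
    {h : List M.Hyp} (ht : t < u.length) :
    M.Cycle t m (u ++ v) x m' s h ↔ ∃ u', s = u' ++ v ∧ M.Cycle t m u x m' u' h := by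
  have e : M.initCfg m (u ++ v) x = (M.initCfg m u x).under v := rfl
  have hl : (M.initCfg m u x).stack = u := rfl
  -- One symbol of `u` must survive all `t` steps, since the halting test still reads the top of the
  -- stack; hence the strict inequality `ht`.
  have hne : (M.runFor t (M.initCfg m u x)).stack ≠ [] := by
    have := (length_runFor t (M.initCfg m u x)).1
    intro h
    rw [h, hl] at this
    simp at this
    omega
  unfold Cycle
  rw [e, runFor_under (by rw [hl]; exact ht.le), step_under hne, Option.map_eq_none_iff]
  constructor
  · rintro ⟨h1, h2, h3⟩
    exact ⟨_, h3.symm, h1, h2, rfl⟩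
  · rintro ⟨u', rfl, h1, h2, rfl⟩
    exact ⟨h1, h2, rfl⟩

theorem Cycle.length_le {t : ℕ} {m m' : List M.Mem} {s s' : List M.Stk} {x : List Bool}
    {h : List M.Hyp} (H : M.Cycle t m s x m' s' h) : s'.length ≤ s.length + t := by
  rw [← H.2.2]
  exact (length_runFor t (M.initCfg m s x)).2

end StackLearner

/-! ### Finite histories -/

/-- The first `i` members of a sequence. -/
def hist {α : Type} (T : ℕ → α) (i : ℕ) : List α := (List.range i).map T

theorem hist_succ {α : Type} (T : ℕ → α) (i : ℕ) : hist T (i + 1) = hist T i ++ [T i] := by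
  simp [hist, List.range_succ]

theorem length_hist {α : Type} (T : ℕ → α) (i : ℕ) : (hist T i).length = i := by
  simp [hist]

/-- The list `σ` followed by the sequence `κ`. -/
def seqAppend {α : Type} (σ : List α) (κ : ℕ → α) : ℕ → α :=
  fun j => (σ[j]?).getD (κ (j - σ.length))

theorem seqAppend_add {α : Type} (σ : List α) (κ : ℕ → α) (j : ℕ) :
    seqAppend σ κ (σ.length + j) = κ j := by
  simp [seqAppend]

theorem hist_seqAppend_length {α : Type} (σ : List α) (κ : ℕ → α) :
    hist (seqAppend σ κ) σ.length = σ := by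
  apply List.ext_getElem
  · simp [length_hist]
  · intro j h1 h2
    simp [hist, seqAppend, h2]

theorem hist_seqAppend {α : Type} (σ : List α) (κ : ℕ → α) (j : ℕ) :
    hist (seqAppend σ κ) (σ.length + j) = σ ++ hist κ j := by
  induction j with
  | zero => rw [add_zero, hist_seqAppend_length]; simp [hist]
  | succ j ih => rw [← add_assoc, hist_succ, ih, seqAppend_add, hist_succ, List.append_assoc]

theorem range_seqAppend {α : Type} (σ : List α) (κ : ℕ → α) :
    Set.range (seqAppend σ κ) = {x | x ∈ σ} ∪ Set.range κ := by
  ext x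
  constructor
  · rintro ⟨j, rfl⟩
    by_cases hj : j < σ.length
    · left
      simp [seqAppend, hj]
    · right
      exact ⟨j - σ.length, by simp [seqAppend, not_lt.mp hj]⟩
  · rintro (hx | ⟨j, rfl⟩)
    · obtain ⟨j, hj, rfl⟩ := List.mem_iff_getElem.mp hx
      exact ⟨j, by simp [seqAppend, hj]⟩
    · exact ⟨σ.length + j, seqAppend_add σ κ j⟩

/-! ### Configurations as a function of the data -/

namespace StackLearner

variable {M : StackLearner}

/-- The parameter `n` in the cycle with the last datum of a finite sequence of data. -/
def listSize (σ : List (List Bool)) : ℕ :=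
  Nat.log 2 σ.length + (Finset.range σ.length).sup fun j => (σ.getD j []).length

theorem listSize_hist (T : ℕ → List Bool) (i : ℕ) :
    listSize (hist T (i + 1)) = sizeParam T i := by
  simp only [listSize, sizeParam, length_hist]
  congr 1
  refine Finset.sup_congr rfl fun j hj => ?_
  have hj' : j < i + 1 := Finset.mem_range.mp hj
  simp [hist, hj']

theorem listSize_le_append (σ ρ : List (List Bool)) : listSize σ ≤ listSize (σ ++ ρ) := by
  unfold listSize
  refine add_le_add (Nat.log_mono_right (by simp)) ?_
  refine Finset.sup_le fun j hj => ?_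
  have hj' : j < σ.length := Finset.mem_range.mp hj
  have : (σ.getD j []) = (σ ++ ρ).getD j [] := by
    simp [hj', List.getElem?_append_left]
  rw [this]
  exact Finset.le_sup (f := fun j => ((σ ++ ρ).getD j []).length)
    (Finset.mem_range.mpr (by simp; omega))

theorem listSize_le {σ : List (List Bool)} {k l : ℕ} (hk : σ.length < 2 ^ (k + 1))
    (hl : ∀ x ∈ σ, x.length ≤ l) : listSize σ ≤ k + l := by
  unfold listSize
  refine add_le_add (Nat.lt_succ_iff.mp (Nat.log_lt_of_lt_pow' (by simp) hk)) ?_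
  refine Finset.sup_le fun j hj => ?_
  have hj' : j < σ.length := Finset.mem_range.mp hj
  simpa [hj'] using hl _ (List.getElem_mem hj')

open Classical in
/-- The memory, the stack content and the hypothesis after a cycle with datum `x` that is started
with the memory and the stack content in `p` (and a default value if there are none). -/
noncomputable def cycleResult (M : StackLearner) (p : List M.Mem × List M.Stk) (x : List Bool) :
    (List M.Mem × List M.Stk) × List M.Hyp :=
  if h : ∃ q : (List M.Mem × List M.Stk) × List M.Hyp, ∃ t, M.Cycle t p.1 p.2 x q.1.1 q.1.2 q.2
  then h.choose else (p, [])

theorem Cycle.cycleResult_eq {t : ℕ} {p : List M.Mem × List M.Stk} {x : List Bool}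
    {q : List M.Mem × List M.Stk} {d : List M.Hyp} (H : M.Cycle t p.1 p.2 x q.1 q.2 d) :
    M.cycleResult p x = (q, d) := by
  have h : ∃ q : (List M.Mem × List M.Stk) × List M.Hyp, ∃ t,
      M.Cycle t p.1 p.2 x q.1.1 q.1.2 q.2 := ⟨(q, d), t, H⟩
  rw [cycleResult, dif_pos h]
  obtain ⟨t', ht'⟩ := h.choose_spec
  obtain ⟨e1, e2, e3⟩ := ht'.unique H
  exact Prod.ext (Prod.ext e1 e2) e3

/-- The memory and the stack content after a finite sequence of data. -/
noncomputable def conf (M : StackLearner) (σ : List (List Bool)) : List M.Mem × List M.Stk :=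
  σ.foldl (fun p x => (M.cycleResult p x).1) (M.initMem, [])

theorem conf_concat (σ : List (List Bool)) (x : List Bool) :
    M.conf (σ ++ [x]) = (M.cycleResult (M.conf σ) x).1 := by
  simp [conf]

theorem IsTrace.eq_conf {T : ℕ → List Bool} {t : ℕ → ℕ} {τ : M.Trace} (H : M.IsTrace T t τ)
    (i : ℕ) : (τ.mem i, τ.stk i) = M.conf (hist T i) := by
  induction i with
  | zero => rw [H.1, H.2.1]; rfl
  | succ i ih =>
    rw [hist_succ, conf_concat, ← ih]
    have := Cycle.cycleResult_eq (p := (τ.mem i, τ.stk i))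
      (q := (τ.mem (i + 1), τ.stk (i + 1))) (H.2.2 i)
    rw [this]

/-- The hypothesis in cycle `i` on the data `T`. -/
noncomputable def hypAt (M : StackLearner) (T : ℕ → List Bool) (i : ℕ) : List M.Hyp :=
  (M.cycleResult (M.conf (hist T i)) (T i)).2

theorem IsTrace.hyp_eq {T : ℕ → List Bool} {t : ℕ → ℕ} {τ : M.Trace} (H : M.IsTrace T t τ)
    (i : ℕ) : τ.hyp i = M.hypAt T i := by
  rw [hypAt, ← H.eq_conf i]
  have := Cycle.cycleResult_eq (p := (τ.mem i, τ.stk i))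
      (q := (τ.mem (i + 1), τ.stk (i + 1))) (H.2.2 i)
  rw [this]

/-- The resource bounds with a given constant. -/
def LinearTimeWith (M : StackLearner) (c : ℕ) : Prop :=
  ∀ T : ℕ → List Bool, ∃ τ : M.Trace,
    M.IsTrace T (fun i => c * (sizeParam T i + 1)) τ ∧
      ∀ i, (τ.mem (i + 1)).length ≤ sizeParam T i + c ∧ (τ.hyp i).length ≤ sizeParam T i + c

/-- The bounds in a cycle depend only on the data so far, so any infinite continuation will do; here
`x` is repeated. -/
theorem LinearTimeWith.cycle {c : ℕ} (hM : M.LinearTimeWith c) (σ : List (List Bool))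
    (x : List Bool) :
    M.Cycle (c * (listSize (σ ++ [x]) + 1)) (M.conf σ).1 (M.conf σ).2 x
        (M.conf (σ ++ [x])).1 (M.conf (σ ++ [x])).2 (M.cycleResult (M.conf σ) x).2 ∧
      (M.conf (σ ++ [x])).1.length ≤ listSize (σ ++ [x]) + c := by
  set T := seqAppend σ fun _ => x with hT
  obtain ⟨τ, hτ, hb⟩ := hM T
  have h0 : hist T σ.length = σ := hist_seqAppend_length _ _
  have hx : T σ.length = x := seqAppend_add σ (fun _ => x) 0
  have h1 : hist T (σ.length + 1) = σ ++ [x] := by rw [hist_succ, h0, hx]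
  have e0 := hτ.eq_conf σ.length
  have e1 := hτ.eq_conf (σ.length + 1)
  have e2 := hτ.hyp_eq σ.length
  have hc := hτ.2.2 σ.length
  have hb := (hb σ.length).1
  rw [hypAt, h0, hx] at e2
  rw [h0] at e0
  rw [h1] at e1
  rw [← listSize_hist, h1] at hb
  simp only [← listSize_hist, h1] at hc
  rw [← e2, ← e0, ← e1]
  rw [hx] at hc
  exact ⟨hc, hb⟩

/-- Two runs with the same memory and the same upper part `u` of the stack continue alike on a
datum if `u` is longer than the number of steps of the first one. -/
theorem LinearTimeWith.cycle_local {c : ℕ} (hM : M.LinearTimeWith c) {σ : List (List Bool)}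
    {x : List Bool} {u v : List M.Stk} (hσ : (M.conf σ).2 = u ++ v)
    (hu : c * (listSize (σ ++ [x]) + 1) < u.length) :
    ∃ u', (M.conf (σ ++ [x])).2 = u' ++ v ∧ ∀ (σ' : List (List Bool)) (v' : List M.Stk),
      (M.conf σ').1 = (M.conf σ).1 → (M.conf σ').2 = u ++ v' →
        (M.conf (σ' ++ [x])).1 = (M.conf (σ ++ [x])).1 ∧ (M.conf (σ' ++ [x])).2 = u' ++ v' ∧
          (M.cycleResult (M.conf σ') x).2 = (M.cycleResult (M.conf σ) x).2 := by
  have h := (hM.cycle σ x).1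
  rw [hσ, cycle_append hu] at h
  obtain ⟨u', e, h⟩ := h
  refine ⟨u', e, fun σ' v' h1 h2 => ?_⟩
  have h' := (cycle_append (v := v') (s := u' ++ v') hu).mpr ⟨u', rfl, h⟩
  rw [← h1, ← h2] at h'
  have e' := h'.cycleResult_eq (p := M.conf σ') (q := ((M.conf (σ ++ [x])).1, u' ++ v'))
  rw [conf_concat, e']
  exact ⟨rfl, rfl, rfl⟩

/-- The symbols `v` at the bottom of the stack are still there after the data `ρ` if the stack
remains much higher meanwhile. -/
theorem LinearTimeWith.suffix_append {c : ℕ} (hM : M.LinearTimeWith c) {σ : List (List Bool)}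
    {v : List M.Stk} (hσ : v <:+ (M.conf σ).2) (ρ : List (List Bool))
    (hρ : ∀ ρ₁ x, ρ₁ ++ [x] <+: ρ →
      v.length + c * (listSize (σ ++ (ρ₁ ++ [x])) + 1) < (M.conf (σ ++ ρ₁)).2.length) :
    v <:+ (M.conf (σ ++ ρ)).2 := by
  induction ρ using List.reverseRecOn with
  | nil => simpa using hσ
  | append_singleton ρ x ih =>
    obtain ⟨u, hu⟩ := ih fun ρ₁ y h => hρ ρ₁ y (h.trans (List.prefix_append _ _))
    have h1 := hρ ρ x List.prefix_rfl
    rw [← hu, List.length_append, ← List.append_assoc] at h1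
    obtain ⟨u', hu', -⟩ := hM.cycle_local (x := x) hu.symm (by omega)
    rw [← List.append_assoc, hu']
    exact List.suffix_append _ _

theorem LinearTimeWith.length_stk_le {c n : ℕ} (hM : M.LinearTimeWith c)
    (σ : List (List Bool)) (hσ : listSize σ ≤ n) :
    (M.conf σ).2.length ≤ σ.length * (c * (n + 1)) := by
  induction σ using List.reverseRecOn with
  | nil => simp [conf]
  | append_singleton σ x ih =>
    have h1 := ih ((listSize_le_append σ [x]).trans hσ)
    have h2 := (hM.cycle σ x).1.length_le
    have h3 : c * (listSize (σ ++ [x]) + 1) ≤ c * (n + 1) := Nat.mul_le_mul_left _ (by omega)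
    simp only [List.length_append, List.length_singleton, add_mul, one_mul]
    omega

/-! ### Collisions contradict learning -/

/-- The learner does not have the same memory and stack content (at least as far as it uses the
latter) after two finite sequences of data each of which has a datum that the other one lacks. -/
theorem LinearTimeWith.no_collision {c : ℕ} (hM : M.LinearTimeWith c)
    {H : List M.Hyp → Set (List Bool)}
    (hL : M.LearnsClass H (Set.range fun e : List Bool => {x : List Bool | x ≠ e}))
    {σ σ' : List (List Bool)} {g g' : List Bool} (hg : g ∈ σ) (hg₁ : g ∉ σ') (hg' : g' ∈ σ')
    (hg₁' : g' ∉ σ) {κ : ℕ → List Bool} (hκ : Set.range κ = {x | x ≠ g ∧ x ≠ g'})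
    {u v v' : List M.Stk} (hm : (M.conf σ').1 = (M.conf σ).1) (hs : (M.conf σ).2 = u ++ v)
    (hs' : (M.conf σ').2 = u ++ v')
    (hv : v = v' ∨ ∀ j, v.length + c * (listSize (σ ++ hist κ (j + 1)) + 1) <
      (M.conf (σ ++ hist κ j)).2.length) : False := by
  -- Either the configurations agree entirely, or the stack stays so high above `v` that the run
  -- after `σ` never reads `v`, and the run after `σ'` copies it on top of `v'`.
  have hyp_eq : ∀ j, M.hypAt (seqAppend σ' κ) (σ'.length + j) =
      M.hypAt (seqAppend σ κ) (σ.length + j) := by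
    simp only [hypAt, hist_seqAppend, seqAppend_add]
    rcases hv with rfl | hv
    · intro j
      congr 2
      simp only [conf, List.foldl_append]
      congr 1
      exact Prod.ext hm (hs'.trans hs.symm)
    · have key : ∀ j, (M.conf (σ' ++ hist κ j)).1 = (M.conf (σ ++ hist κ j)).1 ∧
          ∃ w, (M.conf (σ ++ hist κ j)).2 = w ++ v ∧ (M.conf (σ' ++ hist κ j)).2 = w ++ v' := by
        intro j
        induction j with
        | zero => simpa [hist] using ⟨hm, u, hs, hs'⟩
        | succ j ih =>
          obtain ⟨h1, w, h2, h3⟩ := ih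
          have h4 := hv j
          rw [h2, List.length_append, hist_succ, ← List.append_assoc] at h4
          obtain ⟨w', h5, h6⟩ := hM.cycle_local (x := κ j) h2 (by omega)
          obtain ⟨h7, h8, -⟩ := h6 _ v' h1 h3
          rw [hist_succ, ← List.append_assoc, ← List.append_assoc]
          exact ⟨h7, w', h5, h8⟩
      intro j
      obtain ⟨h1, w, h2, h3⟩ := key j
      have h4 := hv j
      rw [h2, List.length_append, hist_succ, ← List.append_assoc] at h4
      obtain ⟨w', h5, h6⟩ := hM.cycle_local (x := κ j) h2 (by omega)
      exact (h6 _ v' h1 h3).2.2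
  have hne : g ≠ g' := fun h => hg₁' (h ▸ hg)
  have r1 : Set.range (seqAppend σ κ) = {x | x ≠ g'} := by
    rw [range_seqAppend, hκ]
    ext x
    simp only [Set.mem_union, Set.mem_ofPred_eq]
    constructor
    · rintro (h | h)
      · rintro rfl; exact hg₁' h
      · exact h.2
    · intro h
      by_cases hx : x = g
      · left; rw [hx]; exact hg
      · exact Or.inr ⟨hx, h⟩
  have r2 : Set.range (seqAppend σ' κ) = {x | x ≠ g} := by
    rw [range_seqAppend, hκ]
    ext x
    simp only [Set.mem_union, Set.mem_ofPred_eq]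
    constructor
    · rintro (h | h)
      · rintro rfl; exact hg₁ h
      · exact h.1
    · intro h
      by_cases hx : x = g'
      · left; rw [hx]; exact hg'
      · exact Or.inr ⟨h, hx⟩
  obtain ⟨t, τ, hτ, k, d, hd, hk⟩ := hL _ ⟨g', rfl⟩ _ r1
  obtain ⟨t', τ', hτ', k', d', hd', hk'⟩ := hL _ ⟨g, rfl⟩ _ r2
  -- Past both points of convergence, one common hypothesis would have to denote both languages.
  have e1 := hk (σ.length + (k + k')) (by omega)
  have e2 := hk' (σ'.length + (k + k')) (by omega)
  rw [hτ.hyp_eq] at e1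
  rw [hτ'.hyp_eq, hyp_eq, e1] at e2
  rw [e2, hd'] at hd
  exact (Set.ext_iff.mp hd g).mpr hne rfl

/-- Full agreement needs no condition on the stack height, so any enumeration of the remaining words
is a suitable continuation. -/
theorem LinearTimeWith.conf_ne {c : ℕ} (hM : M.LinearTimeWith c)
    {H : List M.Hyp → Set (List Bool)}
    (hL : M.LearnsClass H (Set.range fun e : List Bool => {x : List Bool | x ≠ e}))
    {σ σ' : List (List Bool)} {g g' : List Bool} (hg : g ∈ σ) (hg₁ : g ∉ σ') (hg' : g' ∈ σ')
    (hg₁' : g' ∉ σ) : M.conf σ ≠ M.conf σ' := by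
  intro h
  have hne : {x : List Bool | x ≠ g ∧ x ≠ g'}.Nonempty := by
    obtain ⟨x, hx⟩ := Infinite.exists_notMem_finset ({g, g'} : Finset (List Bool))
    exact ⟨x, by simpa using hx⟩
  obtain ⟨κ, hκ⟩ := (Set.to_countable _).exists_eq_range hne
  exact hM.no_collision hL hg hg₁ hg' hg₁' hκ.symm (u := (M.conf σ).2) (v := []) (v' := [])
    (by rw [h]) (by simp) (by simp [h]) (Or.inl rfl)

end StackLearner

/-! ### Words and choices of words -/

/-- The words of length at most `m` over a finite alphabet, as functions on a fixed finite type. -/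
def padWord {α : Type} (m : ℕ) (l : List α) : Fin m → Option α := fun j => l[(j : ℕ)]?

theorem padWord_inj {α : Type} {m : ℕ} {l l' : List α} (hl : l.length ≤ m) (hl' : l'.length ≤ m)
    (h : padWord m l = padWord m l') : l = l' := by
  apply List.ext_getElem?
  intro j
  by_cases hj : j < m
  · exact congrFun h ⟨j, hj⟩
  · rw [List.getElem?_eq_none (by omega), List.getElem?_eq_none (by omega)]

/-- The list of the words `s w :: w` with `w` of length `i`: for each of the `2 ^ i` pairs of words
of length `i + 1` that differ in the first bit only, `s` selects one of the two. -/
noncomputable def choiceWords (i : ℕ) (s : (Fin i → Bool) → Bool) : List (List Bool) :=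
  (Finset.univ : Finset (Fin i → Bool)).toList.map fun w => s w :: List.ofFn w

theorem length_choiceWords (i : ℕ) (s : (Fin i → Bool) → Bool) :
    (choiceWords i s).length = 2 ^ i := by
  simp [choiceWords]

theorem length_of_mem_choiceWords {i : ℕ} {s : (Fin i → Bool) → Bool} {x : List Bool}
    (hx : x ∈ choiceWords i s) : x.length = i + 1 := by
  simp only [choiceWords, List.mem_map] at hx
  obtain ⟨w, -, rfl⟩ := hx
  simp

theorem cons_ofFn_mem_choiceWords {i : ℕ} {s : (Fin i → Bool) → Bool} {b : Bool}
    {w : Fin i → Bool} : b :: List.ofFn w ∈ choiceWords i s ↔ b = s w := by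
  simp only [choiceWords, List.mem_map, Finset.mem_toList, Finset.mem_univ, true_and,
    List.cons.injEq]
  constructor
  · rintro ⟨w', h1, h2⟩
    rw [← h1, List.ofFn_injective h2]
  · rintro rfl
    exact ⟨w, rfl, rfl⟩

/-- All words of length at most `i`. -/
def wordsUpTo : ℕ → List (List Bool)
  | 0 => [[]]
  | i + 1 => [] :: ((wordsUpTo i).map (List.cons false) ++ (wordsUpTo i).map (List.cons true))

theorem length_wordsUpTo (i : ℕ) : (wordsUpTo i).length < 2 ^ (i + 1) := by
  induction i with
  | zero => simp [wordsUpTo]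
  | succ i ih =>
    simp only [wordsUpTo, List.length_cons, List.length_append, List.length_map]
    rw [pow_succ]
    omega

theorem mem_wordsUpTo {i : ℕ} {x : List Bool} : x ∈ wordsUpTo i ↔ x.length ≤ i := by
  induction i generalizing x with
  | zero => simp [wordsUpTo]
  | succ i ih =>
    cases x with
    | nil => simp [wordsUpTo]
    | cons b x => cases b <;> simp [wordsUpTo, ih]

/-! ### Protecting a level of the stack -/

namespace StackLearner

variable {M : StackLearner}

/-- A bound for the number of pairs of a memory content with parameter `n` and a stack content of
at most `c * (n + 1) + 1` symbols. -/
noncomputable def confCount (M : StackLearner) (c n : ℕ) : ℕ :=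
  (Nat.card M.Mem + 1) ^ (n + c) * (Nat.card M.Stk + 1) ^ (c * (n + 1) + 1)

/-- Pigeonhole principle for memory and stack contents. -/
theorem exists_ne_conf_eq (M : StackLearner) {ι : Type} [Finite ι] {c n Λ : ℕ}
    (hcard : Λ * M.confCount c n < Nat.card ι) (lev : ι → ℕ) (m : ι → List M.Mem)
    (u : ι → List M.Stk) (hlev : ∀ s, lev s < Λ) (hm : ∀ s, (m s).length ≤ n + c)
    (hu : ∀ s, (u s).length ≤ c * (n + 1) + 1) :
    ∃ s s', s ≠ s' ∧ lev s = lev s' ∧ m s = m s' ∧ u s = u s' := by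
  have := M.finite_mem
  have := M.finite_stk
  let f : ι → Fin Λ × (Fin (n + c) → Option M.Mem) × (Fin (c * (n + 1) + 1) → Option M.Stk) :=
    fun s => (⟨lev s, hlev s⟩, padWord _ (m s), padWord _ (u s))
  have hf : ¬ Function.Injective f := by
    intro hf
    have := Nat.card_le_card_of_injective f hf
    rw [Nat.card_prod, Nat.card_prod, Nat.card_fun, Nat.card_fun, Finite.card_option,
      Finite.card_option, Nat.card_fin, Nat.card_fin, Nat.card_fin] at this
    exact absurd hcard (not_lt.mpr this)
  simp only [Function.Injective, not_forall] at hf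
  obtain ⟨s, s', h, hne⟩ := hf
  simp only [f, Prod.mk.injEq, Fin.mk.injEq] at h
  exact ⟨s, s', hne, h.1, padWord_inj (hm s) (hm s') h.2.1, padWord_inj (hu s) (hu s') h.2.2⟩

theorem LinearTimeWith.length_mem_le {c : ℕ} (hM : M.LinearTimeWith c) {σ : List (List Bool)}
    (hσ : σ ≠ []) : (M.conf σ).1.length ≤ listSize σ + c := by
  rw [← List.dropLast_append_getLast hσ]
  exact (hM.cycle _ _).2

/-- Some choice of words of length `i + 1` prevents the learner from coming down to a lower part of
the stack, as long as no further words of that length occur. -/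
theorem LinearTimeWith.exists_protecting {c : ℕ} (hM : M.LinearTimeWith c)
    {H : List M.Hyp → Set (List Bool)}
    (hL : M.LearnsClass H (Set.range fun e : List Bool => {x : List Bool | x ≠ e}))
    {η : List (List Bool)} {i n Λ : ℕ} (hη : ∀ x ∈ η, x.length ≠ i + 1)
    (lev : ((Fin i → Bool) → Bool) → ℕ) (hlev : ∀ s, lev s < Λ)
    (hv : ∀ s, ∃ v, v.length = lev s ∧ v <:+ (M.conf η).2 ∧
      v <:+ (M.conf (η ++ choiceWords i s)).2)
    (hcard : Λ * M.confCount c n < 2 ^ 2 ^ i) :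
    ∃ s, ∀ ρ, (∀ x ∈ ρ, x.length ≠ i + 1) → listSize (η ++ choiceWords i s ++ ρ) ≤ n →
      lev s + (c * (n + 1) + 1) ≤ (M.conf (η ++ choiceWords i s ++ ρ)).2.length := by
  by_contra! hbad
  -- For each `s` take a shortest `ρ` that brings the stack down. Before each of its data the stack
  -- is still high, so the lowest `lev s` symbols are untouched and remain those after `η`.
  have hmin : ∀ s, ∃ ρ u v, (∀ x ∈ ρ, x.length ≠ i + 1) ∧
      listSize (η ++ choiceWords i s ++ ρ) ≤ n ∧ v.length = lev s ∧ v <:+ (M.conf η).2 ∧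
      (M.conf (η ++ choiceWords i s ++ ρ)).2 = u ++ v ∧ u.length ≤ c * (n + 1) + 1 := by
    intro s
    obtain ⟨v, hvl, hv1, hv2⟩ := hv s
    have hex : ∃ l ρ, ρ.length = l ∧ (∀ x ∈ ρ, x.length ≠ i + 1) ∧
        listSize (η ++ choiceWords i s ++ ρ) ≤ n ∧
        (M.conf (η ++ choiceWords i s ++ ρ)).2.length < lev s + (c * (n + 1) + 1) := by
      obtain ⟨ρ, h⟩ := hbad s
      exact ⟨_, ρ, rfl, h⟩
    classical
    obtain ⟨ρ, hl, h1, h2, h3⟩ := Nat.find_spec hex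
    have hsuf : v <:+ (M.conf (η ++ choiceWords i s ++ ρ)).2 := by
      refine hM.suffix_append hv2 ρ fun ρ₁ x hρ => ?_
      obtain ⟨ρ₂, rfl⟩ := hρ
      have hsz : listSize (η ++ choiceWords i s ++ (ρ₁ ++ [x])) ≤ n := by
        refine le_trans ?_ h2
        rw [← List.append_assoc (η ++ choiceWords i s) (ρ₁ ++ [x])]
        exact listSize_le_append _ _
      have hnot := Nat.find_min hex (m := ρ₁.length) (by rw [← hl]; simp)
      simp only [not_exists, not_and, not_lt] at hnot
      have := hnot ρ₁ rfl (fun y hy => h1 y (by simp [hy])) (by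
        refine le_trans ?_ hsz
        rw [← List.append_assoc]
        exact listSize_le_append _ _)
      have h4 := Nat.mul_le_mul_left c (Nat.add_le_add_right hsz 1)
      omega
    obtain ⟨u, hu⟩ := hsuf
    refine ⟨ρ, u, v, h1, h2, hvl, hv1, hu.symm, ?_⟩
    rw [← hu, List.length_append] at h3
    omega
  choose ρ u v hρ hsz hvl hv1 huv hul using hmin
  -- The bottom part need not be counted: it is a suffix of the fixed stack after `η`, determined by
  -- its length `lev s`.
  obtain ⟨s, s', hne, e1, e2, e3⟩ := M.exists_ne_conf_eq (ι := (Fin i → Bool) → Bool) (n := n)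
    (c := c) (Λ := Λ) (by simpa using hcard) lev
    (fun s => (M.conf (η ++ choiceWords i s ++ ρ s)).1) u hlev
    (fun s => (hM.length_mem_le (by
      intro h
      have := congrArg List.length h
      simp [length_choiceWords] at this)).trans (Nat.add_le_add_right (hsz s) c)) hul
  -- The choices differ at `w`. Neither `η` nor the continuations contain words of length `i + 1`,
  -- so the two words ending in `w` separate the data.
  obtain ⟨w, hw⟩ := Function.ne_iff.mp hne
  have hmem : ∀ t b, b :: List.ofFn w ∈ η ++ choiceWords i t ++ ρ t ↔ b = t w := by
    intro t b
    rw [List.mem_append, List.mem_append, cons_ofFn_mem_choiceWords]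
    constructor
    · rintro ((h | h) | h)
      · exact absurd (by simp) (hη _ h)
      · exact h
      · exact absurd (by simp) (hρ t _ h)
    · exact fun h => Or.inl (Or.inr h)
  have hv' : v s = v s' := by
    obtain ⟨a, ha⟩ := hv1 s
    obtain ⟨b, hb⟩ := hv1 s'
    exact (List.append_inj' (ha.trans hb.symm) (by rw [hvl, hvl, e1])).2
  exact hM.conf_ne hL ((hmem s _).mpr rfl) (fun h => hw ((hmem s' _).mp h)) ((hmem s' _).mpr rfl)
    (fun h => hw ((hmem s _).mp h).symm)
    (Prod.ext e2 (by rw [huv, huv, e3, hv']))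

end StackLearner

/-! ### Numerical estimates -/

theorem exists_mul_add_lt_two_pow (a d : ℕ) : ∃ b, ∀ i, b ≤ i → a * i + d < 2 ^ i := by
  refine ⟨2 * (2 * a + d + 2), fun i hi => ?_⟩
  -- Squaring `k + 1 ≤ 2 ^ k` gives a quadratic lower bound for `2 ^ i`.
  obtain ⟨k, hk⟩ : ∃ k, k = i / 2 := ⟨_, rfl⟩
  have h1 : k < 2 ^ k := Nat.lt_two_pow_self
  have h2 : 2 ^ k * 2 ^ k ≤ 2 ^ i := by
    rw [← pow_add]; exact Nat.pow_le_pow_right (by norm_num) (by omega)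
  have h3 : (k + 1) * (k + 1) ≤ 2 ^ k * 2 ^ k := Nat.mul_le_mul h1 h1
  have h4 : (2 * a + d + 3) * (k + 1) ≤ (k + 1) * (k + 1) := Nat.mul_le_mul_right _ (by omega)
  have h5 : a * i ≤ a * (2 * (k + 1)) := Nat.mul_le_mul_left _ (by omega)
  nlinarith [Nat.zero_le ((d + 3) * k)]

namespace StackLearner

theorem confCount_le (M : StackLearner) (c n : ℕ) :
    M.confCount c n ≤
      2 ^ ((Nat.card M.Mem + 1) * (n + c) + (Nat.card M.Stk + 1) * (c * (n + 1) + 1)) := by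
  rw [confCount, pow_add 2, pow_mul 2, pow_mul 2]
  exact Nat.mul_le_mul (Nat.pow_le_pow_left Nat.lt_two_pow_self.le _)
    (Nat.pow_le_pow_left Nat.lt_two_pow_self.le _)

/-- Both left sides are at most `2` to a power linear in `i`; even the number of levels contributes
only a linear exponent. The first estimate serves the protecting choices, the second the final
pigeonhole, where the size bound is that of the next word length. -/
theorem exists_confCount_lt (M : StackLearner) (c : ℕ) :
    ∃ b, ∀ i, b ≤ i →
      (2 ^ i * (c * (2 * i + 5 + 1)) + 1) * M.confCount c (2 * i + 5) < 2 ^ 2 ^ i ∧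
        M.confCount c (2 * i + 7) < 2 ^ 2 ^ i := by
  obtain ⟨a, ha⟩ : ∃ a, a = Nat.card M.Mem + 1 := ⟨_, rfl⟩
  obtain ⟨e, he⟩ : ∃ e, e = Nat.card M.Stk + 1 := ⟨_, rfl⟩
  obtain ⟨b, hb⟩ := exists_mul_add_lt_two_pow (1 + 2 * c + 2 * a + 2 * e * c)
    (8 * c + a * (7 + c) + e * (8 * c + 1))
  refine ⟨b, fun i hi => ⟨?_, ?_⟩⟩
  · have h1 := M.confCount_le c (2 * i + 5)
    rw [← ha, ← he] at h1
    have h2 : 2 ^ i * (c * (2 * i + 5 + 1)) + 1 ≤ 2 ^ (i + c * (2 * i + 5 + 1)) := by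
      rw [pow_add]
      have h3 : c * (2 * i + 5 + 1) + 1 ≤ 2 ^ (c * (2 * i + 5 + 1)) := Nat.lt_two_pow_self
      have h4 := Nat.mul_le_mul_left (2 ^ i) h3
      have h5 : 0 < 2 ^ i := by positivity
      rw [mul_add, mul_one] at h4
      omega
    refine (Nat.mul_le_mul h2 h1).trans_lt ?_
    rw [← pow_add]
    refine Nat.pow_lt_pow_right (by norm_num) (lt_of_le_of_lt ?_ (hb i hi))
    refine Nat.le.intro (k := 2 * c + 2 * a + 2 * e * c) ?_
    ring
  · have h1 := M.confCount_le c (2 * i + 7)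
    rw [← ha, ← he] at h1
    refine h1.trans_lt (Nat.pow_lt_pow_right (by norm_num) (lt_of_le_of_lt ?_ (hb i hi)))
    refine Nat.le.intro (k := 8 * c + (1 + 2 * c) * i) ?_
    ring

end StackLearner

/-! ### Limits of chains of lists -/

theorem exists_seq_of_step {α : Type} {P : ℕ → α → Prop} {R : ℕ → α → α → Prop} {a : α}
    (ha : P 0 a) (h : ∀ n a, P n a → ∃ a', P (n + 1) a' ∧ R n a a') :
    ∃ f : ℕ → α, f 0 = a ∧ ∀ n, P n (f n) ∧ R n (f n) (f (n + 1)) := by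
  choose g hg using h
  let F : ∀ n, {a // P n a} := fun n =>
    Nat.rec ⟨a, ha⟩ (fun n x => ⟨g n x.1 x.2, (hg n x.1 x.2).1⟩) n
  exact ⟨fun n => (F n).1, rfl, fun n => ⟨(F n).2, (hg n (F n).1 (F n).2).2⟩⟩

/-- A strictly increasing sequence of lists has a limit. -/
theorem exists_limit {α : Type} [Inhabited α] {f : ℕ → List α}
    (hf : ∀ n, f n <+: f (n + 1) ∧ (f n).length < (f (n + 1)).length) :
    ∃ κ : ℕ → α, (∀ n, n ≤ (f n).length) ∧ ∀ n j, j ≤ (f n).length → hist κ j <+: f n := by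
  have hlen : ∀ n, n ≤ (f n).length := by
    intro n
    induction n with
    | zero => exact Nat.zero_le _
    | succ n ih => exact Nat.succ_le_of_lt (ih.trans_lt (hf n).2)
  have hmono : ∀ m d, f m <+: f (m + d) := by
    intro m d
    induction d with
    | zero => exact List.prefix_rfl
    | succ d ih => exact ih.trans (hf (m + d)).1
  have hget : ∀ n j, j < (f n).length → (f (j + 1))[j]? = (f n)[j]? := by
    intro n j hj
    have h1 : j < (f (j + 1)).length := hlen (j + 1)
    rcases le_total (j + 1) n with h | h
    · obtain ⟨d, rfl⟩ := Nat.exists_eq_add_of_le h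
      obtain ⟨t, ht⟩ := hmono (j + 1) d
      rw [← ht, List.getElem?_append_left h1]
    · obtain ⟨d, hd⟩ := Nat.exists_eq_add_of_le h
      obtain ⟨t, ht⟩ := hmono n d
      rw [hd, ← ht, List.getElem?_append_left hj]
  -- `f (j + 1)` has more than `j` entries, so the default never occurs.
  refine ⟨fun j => ((f (j + 1))[j]?).getD default, hlen, fun n j hj => ?_⟩
  rw [List.prefix_iff_eq_take, length_hist]
  apply List.ext_getElem
  · simp [length_hist, hj]
  · intro k h1 h2
    rw [length_hist] at h1
    have h3 : k < (f n).length := by omega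
    simp [hist, hget n k h3, h3]

/-! ### Texts that keep the stack high -/

namespace StackLearner

variable {M : StackLearner}

/-- After the data `σ ++ y`, which have not more than `i + 1` bits and of which `y` avoids `g` and
`g'`, the stack has remained above level `k` since `σ` and will do so as long as there are no data
with `i + 1` bits. -/
structure Guarded (M : StackLearner) (c : ℕ) (σ : List (List Bool)) (k : ℕ) (g g' : List Bool)
    (i : ℕ) (y : List (List Bool)) : Prop where
  length_le : ∀ x ∈ σ ++ y, x.length ≤ i + 1
  card_le : (σ ++ y).length ≤ 2 ^ (i + 2)
  avoids : ∀ x ∈ y, x ≠ g ∧ x ≠ g'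
  safe : ∀ y₁ x, y₁ ++ [x] <+: y →
    k + c * (listSize (σ ++ (y₁ ++ [x])) + 1) < (M.conf (σ ++ y₁)).2.length
  protect : ∀ ρ, (∀ x ∈ ρ, x.length ≠ i + 1) → listSize (σ ++ y ++ ρ) ≤ 2 * i + 5 →
    k + (c * (2 * i + 5 + 1) + 1) ≤ (M.conf (σ ++ y ++ ρ)).2.length

/-- The new data avoid length `i + 1`, so the old protection lasts while they are read; their last
part, a choice of words of length `i + 2`, protects level `k` afterwards. Words of length `i + 1`
not yet presented wait for the next stage, when they are harmless. -/
theorem Guarded.exists_succ {c : ℕ} (hM : M.LinearTimeWith c)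
    {H : List M.Hyp → Set (List Bool)}
    (hL : M.LearnsClass H (Set.range fun e : List Bool => {x : List Bool | x ≠ e}))
    {σ : List (List Bool)} {k i : ℕ} {g g' : List Bool} {y : List (List Bool)}
    (hcard : (k + 1) * M.confCount c (2 * (i + 1) + 5) < 2 ^ 2 ^ (i + 1))
    (hg : g.length ≤ i + 1) (hg' : g'.length ≤ i + 1) (h : M.Guarded c σ k g g' i y) :
    ∃ y', M.Guarded c σ k g g' (i + 1) y' ∧ y <+: y' ∧ y.length < y'.length ∧
      ∀ x, x.length ≤ i → x ≠ g → x ≠ g' → x ∈ y' := by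
  set r := (wordsUpTo i).filter fun x => x ≠ g ∧ x ≠ g' with hr
  have hr_mem : ∀ x, x ∈ r ↔ x.length ≤ i ∧ x ≠ g ∧ x ≠ g' := by
    intro x
    simp [hr, mem_wordsUpTo]
  have hr_len : r.length < 2 ^ (i + 1) :=
    (List.length_filter_le _ _).trans_lt (length_wordsUpTo i)
  have hlen : ∀ s, ∀ x ∈ σ ++ y ++ (r ++ choiceWords (i + 1) s), x.length ≤ i + 1 + 1 := by
    intro s x hx
    rcases List.mem_append.mp hx with hx | hx
    · exact (h.length_le x hx).trans (by omega)
    rcases List.mem_append.mp hx with hx | hx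
    · exact ((hr_mem x).mp hx).1.trans (by omega)
    · exact (length_of_mem_choiceWords hx).le
  have hcd : ∀ s, (σ ++ y ++ (r ++ choiceWords (i + 1) s)).length ≤ 2 ^ (i + 1 + 2) := by
    intro s
    have h1 := h.card_le
    rw [List.length_append, List.length_append (as := r), length_choiceWords]
    have e1 : 2 ^ (i + 1 + 2) = 2 ^ (i + 2) + 2 ^ (i + 2) := by ring
    have e2 : 2 ^ (i + 2) = 2 ^ (i + 1) + 2 ^ (i + 1) := by ring
    omega
  -- At most `2 ^ (i + 3)` data of length at most `i + 2`: this is where `2 * i + 5` comes from.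
  have hsz : ∀ s, listSize (σ ++ y ++ (r ++ choiceWords (i + 1) s)) ≤ 2 * i + 5 := by
    intro s
    refine (listSize_le (k := i + 3) ((hcd s).trans_lt ?_) (hlen s)).trans (by omega)
    exact Nat.pow_lt_pow_right (by norm_num) (by omega)
  have hne : ∀ s, ∀ x ∈ r ++ choiceWords (i + 1) s, x.length ≠ i + 1 := by
    intro s x hx
    rcases List.mem_append.mp hx with hx | hx
    · have := ((hr_mem x).mp hx).1
      omega
    · have := length_of_mem_choiceWords hx
      omega
  have hwin : ∀ s z, z <+: r ++ choiceWords (i + 1) s → listSize (σ ++ y ++ z) ≤ 2 * i + 5 ∧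
      k + (c * (2 * i + 5 + 1) + 1) ≤ (M.conf (σ ++ y ++ z)).2.length := by
    rintro s z ⟨t, ht⟩
    have h1 : listSize (σ ++ y ++ z) ≤ 2 * i + 5 := by
      refine le_trans ?_ (hsz s)
      rw [← ht, ← List.append_assoc]
      exact listSize_le_append _ _
    refine ⟨h1, h.protect z (fun x hx => hne s x ?_) h1⟩
    rw [← ht]
    exact List.mem_append_left _ hx
  have hr_win : ∀ s z, z <+: choiceWords (i + 1) s → listSize (σ ++ y ++ r ++ z) ≤ 2 * i + 5 ∧
      k + (c * (2 * i + 5 + 1) + 1) ≤ (M.conf (σ ++ y ++ r ++ z)).2.length := by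
    intro s z hz
    rw [List.append_assoc]
    exact hwin s _ ((List.prefix_append_right_inj r).mpr hz)
  -- All choices now share the level `k`; the lowest `k` symbols survive each of them by the old
  -- protection.
  obtain ⟨s, hs⟩ := hM.exists_protecting hL (η := σ ++ y ++ r) (i := i + 1)
    (n := 2 * (i + 1) + 5) (Λ := k + 1) (fun x hx => by
      rcases List.mem_append.mp hx with hx | hx
      · have := h.length_le x hx
        omega
      · have := ((hr_mem x).mp hx).1
        omega) (fun _ => k) (fun _ => Nat.lt_succ_self k) (fun s => by
      have hk := (hr_win s [] List.nil_prefix).2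
      rw [List.append_nil] at hk
      refine ⟨(M.conf (σ ++ y ++ r)).2.drop ((M.conf (σ ++ y ++ r)).2.length - k), ?_,
        List.drop_suffix _ _, ?_⟩
      · rw [List.length_drop]
        omega
      · refine hM.suffix_append (List.drop_suffix _ _) _ fun ρ₁ x hρ => ?_
        have h1 := (hr_win s _ hρ).1
        have h2 := (hr_win s _ ((List.prefix_append ρ₁ [x]).trans hρ)).2
        have h3 := Nat.mul_le_mul_left c (Nat.add_le_add_right h1 1)
        rw [List.length_drop]
        omega) hcard
  refine ⟨y ++ (r ++ choiceWords (i + 1) s), ⟨?_, ?_, ?_, ?_, ?_⟩, List.prefix_append _ _, ?_, ?_⟩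
  · rw [← List.append_assoc]
    exact hlen s
  · rw [← List.append_assoc]
    exact hcd s
  · intro x hx
    rw [List.mem_append, List.mem_append] at hx
    rcases hx with hx | hx | hx
    · exact h.avoids x hx
    · exact ((hr_mem x).mp hx).2
    · have := length_of_mem_choiceWords hx
      constructor <;> rintro rfl <;> omega
  · intro y₁ x hy
    by_cases hy' : y₁ ++ [x] <+: y
    · exact h.safe y₁ x hy'
    · have hyy : y <+: y₁ ++ [x] :=
        (List.prefix_or_prefix_of_prefix hy (List.prefix_append _ _)).resolve_left hy'
      obtain ⟨t, ht⟩ := hyy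
      rcases List.eq_nil_or_concat' t with rfl | ⟨t', x', rfl⟩
      · exact absurd ⟨[], by rw [← ht, List.append_nil, List.append_nil]⟩ hy'
      · rw [← List.append_assoc] at ht
        obtain ⟨rfl, e⟩ := List.append_inj' ht rfl
        obtain rfl : x' = x := by simpa using e
        rw [List.append_assoc, List.prefix_append_right_inj] at hy
        have h1 := (hwin s _ hy).1
        have h2 := (hwin s _ ((List.prefix_append t' [x']).trans hy)).2
        have h3 := Nat.mul_le_mul_left c (Nat.add_le_add_right h1 1)
        simp only [List.append_assoc] at h2 h3 ⊢
        omega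
  · have e : σ ++ (y ++ (r ++ choiceWords (i + 1) s)) = σ ++ y ++ r ++ choiceWords (i + 1) s := by
      simp only [List.append_assoc]
    rw [e]
    exact hs
  · rw [List.length_append, List.length_append, length_choiceWords]
    have : 0 < 2 ^ (i + 1) := by positivity
    omega
  · intro x hx h1 h2
    exact List.mem_append_right _ (List.mem_append_left _ ((hr_mem x).mpr ⟨hx, h1, h2⟩))

/-- Safety concerns finite prefixes and so passes to the limit, and every admissible word is
delivered at some stage determined by its length. -/
theorem Guarded.exists_seq {c : ℕ} (hM : M.LinearTimeWith c)
    {H : List M.Hyp → Set (List Bool)}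
    (hL : M.LearnsClass H (Set.range fun e : List Bool => {x : List Bool | x ≠ e}))
    {σ : List (List Bool)} {k i : ℕ} {g g' : List Bool} {y : List (List Bool)}
    (hcard : ∀ j, i ≤ j → (k + 1) * M.confCount c (2 * j + 5) < 2 ^ 2 ^ j)
    (hg : g.length ≤ i + 1) (hg' : g'.length ≤ i + 1) (h : M.Guarded c σ k g g' i y) :
    ∃ κ : ℕ → List Bool, Set.range κ = {x | x ≠ g ∧ x ≠ g'} ∧
      ∀ j, k + c * (listSize (σ ++ hist κ (j + 1)) + 1) <
        (M.conf (σ ++ hist κ j)).2.length := by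
  obtain ⟨f, -, hf⟩ := exists_seq_of_step (P := fun n y => M.Guarded c σ k g g' (i + n) y)
    (R := fun n y y' => y <+: y' ∧ y.length < y'.length ∧
      ∀ x : List Bool, x.length ≤ i + n → x ≠ g → x ≠ g' → x ∈ y') h
    (fun n y hy => hy.exists_succ hM hL (hcard (i + n + 1) (by omega))
      (hg.trans (Nat.succ_le_succ (Nat.le_add_right i n)))
      (hg'.trans (Nat.succ_le_succ (Nat.le_add_right i n))))
  obtain ⟨κ, hlen, hκ⟩ := exists_limit fun n => ⟨(hf n).2.1, (hf n).2.2.1⟩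
  refine ⟨κ, ?_, fun j => ?_⟩
  · ext x
    constructor
    · rintro ⟨j, rfl⟩
      have h1 := hκ (j + 1) (j + 1) (hlen _)
      refine (hf (j + 1)).1.avoids _ (h1.subset ?_)
      rw [hist_succ]
      simp
    · rintro ⟨h1, h2⟩
      have hx := (hf x.length).2.2.2 x (by omega) h1 h2
      have e : hist κ (f (x.length + 1)).length = f (x.length + 1) :=
        (hκ _ _ le_rfl).eq_of_length (length_hist _ _)
      rw [← e, hist, List.mem_map] at hx
      obtain ⟨j, -, hj⟩ := hx
      exact ⟨j, hj⟩
  · have h1 := hκ (j + 1) (j + 1) (hlen _)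
    rw [hist_succ] at h1 ⊢
    exact (hf (j + 1)).1.safe _ _ h1

/-- After any choice of words of length `b + 1` there is a choice of words of length `b + 2`, and a
part `σ` of the data presented so far, such that the stack never again comes below its height
after `σ`, apart from a difference bounded in terms of the current data. -/
theorem LinearTimeWith.exists_guarded {c : ℕ} (hM : M.LinearTimeWith c)
    {H : List M.Hyp → Set (List Bool)}
    (hL : M.LearnsClass H (Set.range fun e : List Bool => {x : List Bool | x ≠ e})) {b : ℕ}
    (hcard : (2 ^ (b + 1) * (c * (2 * (b + 1) + 5 + 1)) + 1) * M.confCount c (2 * (b + 1) + 5) <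
      2 ^ 2 ^ (b + 1)) (S : (Fin b → Bool) → Bool) :
    ∃ z y, (∀ x ∈ z, x.length = b + 2) ∧
      listSize (choiceWords b S ++ z) ≤ 2 * (b + 1) + 5 ∧
      ((M.conf (choiceWords b S ++ z)).2.length - (c * (2 * (b + 1) + 5 + 1) + 1) ≤
        2 ^ (b + 1) * (c * (2 * (b + 1) + 5 + 1))) ∧
      (c * (2 * (b + 1) + 5 + 1) + 1 ≤ (M.conf (choiceWords b S ++ z)).2.length →
        ∀ g g' : List Bool, g.length = b + 1 → g'.length = b + 1 →
          M.Guarded c (choiceWords b S ++ z)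
            ((M.conf (choiceWords b S ++ z)).2.length - (c * (2 * (b + 1) + 5 + 1) + 1))
            g g' (b + 1) y) := by
  obtain ⟨n, hn⟩ : ∃ n, n = 2 * (b + 1) + 5 := ⟨_, rfl⟩
  obtain ⟨B, hB⟩ : ∃ B, B = c * (n + 1) + 1 := ⟨_, rfl⟩
  set η := choiceWords b S with hη
  let ht (s : (Fin (b + 1) → Bool) → Bool) (m : ℕ) : ℕ :=
    (M.conf (η ++ (choiceWords (b + 1) s).take m)).2.length
  have hlen : ∀ s, ∀ x ∈ η ++ choiceWords (b + 1) s, x.length ≤ b + 1 + 1 := by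
    intro s x hx
    rcases List.mem_append.mp hx with hx | hx
    · exact (length_of_mem_choiceWords hx).le.trans (by omega)
    · exact (length_of_mem_choiceWords hx).le
  have hcd : ∀ s, (η ++ choiceWords (b + 1) s).length ≤ 2 ^ (b + 1 + 2) := by
    intro s
    rw [List.length_append, length_choiceWords, length_choiceWords]
    have e1 : 2 ^ (b + 1 + 2) = 8 * 2 ^ b := by ring
    have e2 : 2 ^ (b + 1) = 2 * 2 ^ b := by ring
    omega
  have hsz : ∀ s z, z <+: choiceWords (b + 1) s → listSize (η ++ z) ≤ n := by
    rintro s z ⟨t, ht⟩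
    have h1 : listSize (η ++ choiceWords (b + 1) s) ≤ n := by
      refine (listSize_le (k := b + 3) ((hcd s).trans_lt ?_) (hlen s)).trans (by omega)
      exact Nat.pow_lt_pow_right (by norm_num) (by omega)
    refine le_trans ?_ h1
    rw [← ht, ← List.append_assoc]
    exact listSize_le_append _ _
  -- Cutting at the lowest point `m s` leaves just `B` symbols above the level to be protected (if
  -- there are that many), while the rest of the choice never takes the stack lower.
  have hmin : ∀ s, ∃ m, ∀ m', ht s m ≤ ht s m' := fun s =>
    ⟨Function.argmin (ht s), fun m' => Function.argmin_le (ht s) m'⟩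
  choose m hm using hmin
  have hm_prefix : ∀ s z, z <+: choiceWords (b + 1) s →
      ht s (m s) ≤ (M.conf (η ++ z)).2.length := by
    intro s z hz
    rw [List.prefix_iff_eq_take.mp hz]
    exact hm s _
  have hstep : ∀ s, B ≤ ht s (m s) → ∀ ρ₁ x, ρ₁ ++ [x] <+: choiceWords (b + 1) s →
      ht s (m s) - B + c * (listSize (η ++ (ρ₁ ++ [x])) + 1) < (M.conf (η ++ ρ₁)).2.length := by
    intro s hs ρ₁ x hρ
    have h1 := Nat.mul_le_mul_left c (Nat.add_le_add_right (hsz s _ hρ) 1)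
    have h2 := hm_prefix s _ ((List.prefix_append ρ₁ [x]).trans hρ)
    omega
  -- The minimum is at most the height after `η`, hence at most the number of data times the steps
  -- per cycle: singly exponential in `b`.
  have hlev : ∀ s, ht s (m s) - B ≤ 2 ^ (b + 1) * (c * (n + 1)) := by
    intro s
    have h1 := hm_prefix s [] List.nil_prefix
    have h2 := hM.length_stk_le _ (hsz s [] List.nil_prefix)
    rw [List.append_nil] at h1 h2
    rw [hη, length_choiceWords, ← hη] at h2
    have h3 : 2 ^ b * (c * (n + 1)) ≤ 2 ^ (b + 1) * (c * (n + 1)) :=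
      Nat.mul_le_mul_right _ (Nat.pow_le_pow_right (by norm_num) (by omega))
    omega
  rw [← hn] at hcard ⊢
  rw [← hB]
  obtain ⟨s, hs⟩ := hM.exists_protecting hL (η := η) (i := b + 1) (n := n)
    (Λ := 2 ^ (b + 1) * (c * (n + 1)) + 1) (fun x hx => by
      have := length_of_mem_choiceWords hx
      omega) (fun s => ht s (m s) - B) (fun s => Nat.lt_succ_of_le (hlev s)) (fun s => by
      by_cases hs : B ≤ ht s (m s)
      · have hk := hm_prefix s [] List.nil_prefix
        rw [List.append_nil] at hk
        have hl : ((M.conf η).2.drop ((M.conf η).2.length - (ht s (m s) - B))).length =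
            ht s (m s) - B := by
          rw [List.length_drop]
          omega
        refine ⟨_, hl, List.drop_suffix _ _, hM.suffix_append (List.drop_suffix _ _) _ ?_⟩
        rw [hl]
        exact hstep s hs
      -- By truncated subtraction the level is `0` here.
      · exact ⟨[], by simp only [List.length_nil]; omega, List.nil_suffix, List.nil_suffix⟩) hcard
  refine ⟨(choiceWords (b + 1) s).take (m s), (choiceWords (b + 1) s).drop (m s), ?_,
    hsz s _ (List.take_prefix _ _), hlev s, fun hs' g g' hg hg' => ⟨?_, ?_, ?_, ?_, ?_⟩⟩
  · intro x hx
    exact length_of_mem_choiceWords (List.mem_of_mem_take hx)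
  · rw [List.append_assoc, List.take_append_drop]
    exact hlen s
  · rw [List.append_assoc, List.take_append_drop]
    exact hcd s
  · intro x hx
    have := length_of_mem_choiceWords (List.mem_of_mem_drop hx)
    constructor <;> rintro rfl <;> omega
  · intro y₁ x hy
    have h1 := hstep s hs' ((choiceWords (b + 1) s).take (m s) ++ y₁) x (by
      rw [List.append_assoc]
      conv_rhs => rw [← List.take_append_drop (m s) (choiceWords (b + 1) s)]
      exact (List.prefix_append_right_inj _).mpr hy)
    simpa only [List.append_assoc] using h1
  · rw [List.append_assoc, List.take_append_drop, ← hn, ← hB]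
    rw [← hB] at hs
    exact hs

end StackLearner

/-! ### The final collision -/

theorem theorem4p3 (M : StackLearner) (hM : M.LinearTime)
    (H : List M.Hyp → Set (List Bool)) :
    ¬ M.LearnsClass H (Set.range fun e : List Bool => {x : List Bool | x ≠ e}) := by
  intro hL
  obtain ⟨c, hM⟩ := hM
  replace hM : M.LinearTimeWith c := hM
  obtain ⟨b, hb⟩ := M.exists_confCount_lt c
  choose z y hz hsz hlev hguard using
    hM.exists_guarded hL (b := b) (hb (b + 1) (by omega)).1
  -- Only the memory and the top of the stack are compared; the stacks may differ further down, and
  -- so may their heights.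
  obtain ⟨S, S', hne, -, e1, e2⟩ := M.exists_ne_conf_eq (ι := (Fin b → Bool) → Bool)
    (n := 2 * (b + 1) + 5) (c := c) (Λ := 1)
    (by simpa [mul_add, add_assoc] using (hb b le_rfl).2) (fun _ => 0)
    (fun S => (M.conf (choiceWords b S ++ z S)).1)
    (fun S => (M.conf (choiceWords b S ++ z S)).2.take (c * (2 * (b + 1) + 5 + 1) + 1))
    (fun _ => Nat.zero_lt_one)
    (fun S => (hM.length_mem_le (by
      intro h
      have := congrArg List.length h
      simp [length_choiceWords] at this)).trans (Nat.add_le_add_right (hsz S) c))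
    (fun S => List.length_take_le _ _)
  obtain ⟨w, hw⟩ := Function.ne_iff.mp hne
  have hmem : ∀ t a, a :: List.ofFn w ∈ choiceWords b t ++ z t ↔ a = t w := by
    intro t a
    rw [List.mem_append, cons_ofFn_mem_choiceWords]
    refine or_iff_left fun h => ?_
    have := hz t _ h
    simp at this
  have hg := (hmem S _).mpr rfl
  have hg₁ : S w :: List.ofFn w ∉ choiceWords b S' ++ z S' := fun h => hw ((hmem S' _).mp h)
  have hg' := (hmem S' _).mpr rfl
  have hg₁' : S' w :: List.ofFn w ∉ choiceWords b S ++ z S := fun h => hw ((hmem S _).mp h).symm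
  by_cases hB : c * (2 * (b + 1) + 5 + 1) + 1 ≤ (M.conf (choiceWords b S ++ z S)).2.length
  -- It suffices to guard the run after `S`: the run after `S'` imitates it.
  · have hG := hguard S hB (S w :: List.ofFn w) (S' w :: List.ofFn w) (by simp) (by simp)
    obtain ⟨κ, hκ, hsafe⟩ := hG.exists_seq hM hL (fun j hj => by
      refine lt_of_le_of_lt (Nat.mul_le_mul_right _ (Nat.add_le_add_right ?_ 1))
        (hb j (by omega)).1
      refine (hlev S).trans (Nat.mul_le_mul (Nat.pow_le_pow_right (by norm_num) hj)
        (Nat.mul_le_mul_left c (by omega)))) (by simp) (by simp)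
    refine hM.no_collision hL hg hg₁ hg' hg₁' hκ e1.symm
      (List.take_append_drop (c * (2 * (b + 1) + 5 + 1) + 1) _).symm
      (v' := (M.conf (choiceWords b S' ++ z S')).2.drop (c * (2 * (b + 1) + 5 + 1) + 1)) ?_
      (Or.inr ?_)
    · rw [e2, List.take_append_drop]
    · rw [List.length_drop]
      exact hsafe
  -- The stack after `S` is shorter than the compared part, so equal tops are equal stacks.
  · refine hM.conf_ne hL hg hg₁ hg' hg₁' (Prod.ext e1 ?_)
    have h1 := congrArg List.length e2
    simp only [List.length_take] at h1
    rwa [List.take_of_length_le (by omega), List.take_of_length_le (by omega)] at e2
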